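/- **Proposition.** Let $\mathcal A,\mathcal B,\mathcal C$ be measurable spaces and let $\mathcal H_A,\mathcal H_B,\mathcal H_C$ be separable real reproducing kernel Hilbert spaces of functions on $\mathcal A,\mathcal B,\mathcal C$, with measurable kernels $k_A,k_B,k_C$ and canonical feature maps $\phi_A,\phi_B,\phi_C$, where $\phi_A(a)=k_A(\cdot,a)$ and likewise for $B,C$. Let $P$ be a probability measure on $\mathcal A\times\mathcal B\times\mathcal C$, the law of a triple $X=(A,B,C)$. Fix (deterministic) estimated conditional mean embeddings, i.e. measurable maps $\hat\mu_{A|C}:\mathcal C\to\mathcal H_A$ and $\hat\mu_{B|C}:\mathcal C\to\mathcal H_B$, and for $x=(a,b,c)$, $x'=(a',b',c')$ put $$\hat h(x,x') = k_C(c,c')\,\bigl\langle \phi_A(a)-\hat\mu_{A|C}(c),\,\phi_A(a')-\hat\mu_{A|C}(c')\bigr\rangle_{\mathcal H_A}\,\bigl\langle \phi_B(b)-\hat\mu_{B|C}(c),\,\phi_B(b')-\hat\mu_{B|C}(c')\bigr\rangle_{\mathcal H_B}.$$ For $X,X'$ independent with law $P$, assume $\mathbb E[\hat h(X,X')^2]<\infty$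 and set $\widehat{\mathrm{KCI}}=\mathbb E[\hat h(X,X')]$. For an i.i.d. sequence $X_1,X_2,\dots$ with law $P$ set $$\widehat{\mathrm{KCI}}_n=\frac1{n(n-1)}\sum_{1\le i\ne j\le n}\hat h(X_i,X_j).$$ Suppose that the alternative holds, i.e. $A$ and $B$ are not conditionally independent given $C$ (where conditional independence means $\mathbb E[f(A,C)g(B,C)\mid C]=\mathbb E[f(A,C)\mid C]\,\mathbb E[g(B,C)\mid C]$ almost surely for all square-integrable $f(A,C)$, $g(B,C)$). Then there is a scalar $\hat\sigma^2_{\mathfrak H_1}\ge 0$, depending only on $P$, the kernels and $\hat\mu_{A|C},\hat\mu_{B|C}$ (not on $n$ or on the sample), such that, as $n\to\infty$, $$\sqrt n\,\bigl(\widehat{\mathrm{KCI}}_n-\widehat{\mathrm{KCI}}\bigr)\xrightarrow{d}\mathcal N\bigl(0,\hat\sigma^2_{\mathfrak H_1}\bigr),$$ where $\mathcal N(0,0)$ denotes the point mass at $0$. -/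

import Mathlib

open MeasureTheory ProbabilityTheory Filter

noncomputable section

namespace KCI

/-- The canonical feature map `φ x = k(·, x)` of a real RKHS `H` of functions on `S`; it satisfies
the reproducing property `f x = ⟪f, φ x⟫`. -/
def featureMap {S : Type*} (H : Type*) [NormedAddCommGroup H] [InnerProductSpace ℝ H]
    [CompleteSpace H] [RKHS ℝ H S ℝ] (x : S) : H :=
  RKHS.kerFun H x (1 : ℝ)

/-- The reproducing kernel `k(x, y) = ⟪φ x, φ y⟫` of a real RKHS. -/
def kernelFn {S : Type*} (H : Type*) [NormedAddCommGroup H] [InnerProductSpace ℝ H]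
    [CompleteSpace H] [RKHS ℝ H S ℝ] (x y : S) : ℝ :=
  inner ℝ (featureMap H x) (featureMap H y)

/-- Conditional independence of `A` and `B` given `C` (Daudin): for all square-integrable
`f(A, C)` and `g(B, C)`,
`E[f(A, C) g(B, C) | C] = E[f(A, C) | C] E[g(B, C) | C]` almost surely. -/
def CondIndepGiven {Ω 𝒜 ℬ 𝒞 : Type*} [MeasurableSpace Ω] [MeasurableSpace 𝒜] [MeasurableSpace ℬ]
    [m𝒞 : MeasurableSpace 𝒞] (A : Ω → 𝒜) (B : Ω → ℬ) (C : Ω → 𝒞) (μ : Measure Ω) : Prop :=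
  ∀ (f : 𝒜 × 𝒞 → ℝ) (g : ℬ × 𝒞 → ℝ),
    MemLp f 2 (μ.map fun ω => (A ω, C ω)) → MemLp g 2 (μ.map fun ω => (B ω, C ω)) →
    μ[fun ω => f (A ω, C ω) * g (B ω, C ω) | m𝒞.comap C] =ᵐ[μ]
      fun ω => (μ[fun ω => f (A ω, C ω) | m𝒞.comap C]) ω *
        (μ[fun ω => g (B ω, C ω) | m𝒞.comap C]) ω

section Statistic

variable {𝒜 ℬ 𝒞 : Type*} {HA HB : Type*} (HC : Type*)
  [NormedAddCommGroup HA] [InnerProductSpace ℝ HA] [CompleteSpace HA] [RKHS ℝ HA 𝒜 ℝ]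
  [NormedAddCommGroup HB] [InnerProductSpace ℝ HB] [CompleteSpace HB] [RKHS ℝ HB ℬ ℝ]
  [NormedAddCommGroup HC] [InnerProductSpace ℝ HC] [CompleteSpace HC] [RKHS ℝ HC 𝒞 ℝ]

/-- The function `ĥ((a, b, c), (a', b', c'))` equal to
`k_C(c, c') ⟪φ_A a - μ̂_A c, φ_A a' - μ̂_A c'⟫ ⟪φ_B b - μ̂_B c, φ_B b' - μ̂_B c'⟫`. -/
def hHat (μA : 𝒞 → HA) (μB : 𝒞 → HB) (x x' : 𝒜 × ℬ × 𝒞) : ℝ :=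
  kernelFn HC x.2.2 x'.2.2 *
    inner ℝ (featureMap HA x.1 - μA x.2.2) (featureMap HA x'.1 - μA x'.2.2) *
    inner ℝ (featureMap HB x.2.1 - μB x.2.2) (featureMap HB x'.2.1 - μB x'.2.2)

/-- The U-statistic `(n (n - 1))⁻¹ ∑_{i ≠ j} ĥ(x_i, x_j)` of the first `n` points of `x`. -/
def kciHatStat (μA : 𝒞 → HA) (μB : 𝒞 → HB) (n : ℕ) (x : ℕ → 𝒜 × ℬ × 𝒞) : ℝ :=
  ((n : ℝ) * ((n : ℝ) - 1))⁻¹ *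
    ∑ p ∈ (Finset.range n).offDiag, hHat HC μA μB (x p.1) (x p.2)

/-- The population quantity `E ĥ(X, X')` with `X, X'` independent of law `P`. -/
def kciHat [MeasurableSpace 𝒜] [MeasurableSpace ℬ] [MeasurableSpace 𝒞]
    (μA : 𝒞 → HA) (μB : 𝒞 → HB) (P : Measure (𝒜 × ℬ × 𝒞)) : ℝ :=
  ∫ p, hHat HC μA μB p.1 p.2 ∂(P.prod P)

end Statistic

end KCI

end

open KCI

namespace KCI

section UStatistic

variable {S Ω : Type*} [MeasurableSpace S] [MeasurableSpace Ω] {P : Measure S}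
  {ν : Measure Ω} {X : ℕ → Ω → S}

/-! The argument is Hoeffding's: with `g x = E h(x, X')` and `θ = E h(X, X')`, write `h(x, y) - θ =
(g x - θ) + (g y - θ) + r(x, y)`, where `r` integrates to zero in each variable separately. By
`uStat_sub_eq`, the scaled and centred U-statistic is then a normalized i.i.d. sum of `2 g(X_i)`, to
which the classical CLT applies, plus a U-statistic with kernel `r`. Terms of the latter over
distinct unordered pairs are orthogonal (`integral_mul_eq_zero_of_ne`), so its second moment is
O(1/n²) and it vanishes even after multiplication by √n (`tendstoInMeasure_degenerate`). Slutsky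
concludes; `ĥ` enters only as a symmetric square-integrable kernel. -/

/-- The first-order projection `x ↦ E h(x, X')` of a kernel `h`. -/
noncomputable def hajekProj (P : Measure S) (h : S → S → ℝ) (x : S) : ℝ := ∫ y, h x y ∂P

/-- The second-order (degenerate) part of the Hoeffding decomposition of a symmetric kernel. -/
noncomputable def degeneratePart (P : Measure S) (h : S → S → ℝ) (x y : S) : ℝ :=
  h x y - hajekProj P h x - hajekProj P h y + ∫ p, h p.1 p.2 ∂(P.prod P)

lemma degeneratePart_comm {h : S → S → ℝ} (hsymm : ∀ x y, h x y = h y x) (x y : S) :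
    degeneratePart P h x y = degeneratePart P h y x := by
  simp only [degeneratePart, hsymm x y]
  ring

lemma hasLaw_pair [IsProbabilityMeasure ν] (hX : ∀ i, HasLaw (X i) P ν)
    (hind : iIndepFun X ν) {i j : ℕ} (hij : i ≠ j) :
    HasLaw (fun ω => (X i ω, X j ω)) (P.prod P) ν :=
  ⟨(hX i).aemeasurable.prodMk (hX j).aemeasurable, by
    rw [(hind.indepFun hij).map_prod_eq_prod_map_map (hX i).aemeasurable (hX j).aemeasurable,
      (hX i).map_eq, (hX j).map_eq]⟩

lemma memLp_comp_pair [IsProbabilityMeasure ν] (hX : ∀ i, HasLaw (X i) P ν)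
    (hind : iIndepFun X ν) {i j : ℕ} (hij : i ≠ j)
    {r : S → S → ℝ} (hr : MemLp (fun p : S × S => r p.1 p.2) 2 (P.prod P)) :
    MemLp (fun ω => r (X i ω) (X j ω)) 2 ν := by
  have hlaw := hasLaw_pair hX hind hij
  rw [← hlaw.map_eq] at hr
  exact (memLp_map_measure_iff hr.1 hlaw.aemeasurable).1 hr

variable [IsProbabilityMeasure P]

/-- Jensen on almost every section, in the form that the variance of `h x` is nonnegative, bounds
the squared projection by `∫ h(x, y)² dy`, which Fubini makes integrable. -/
lemma memLp_hajekProj {h : S → S → ℝ}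
    (hh : MemLp (fun p : S × S => h p.1 p.2) 2 (P.prod P)) : MemLp (hajekProj P h) 2 P := by
  have hmeas : AEStronglyMeasurable (hajekProj P h) P := hh.1.integral_prod_right'
  have hsq : Integrable (fun p : S × S => h p.1 p.2 ^ 2) (P.prod P) := hh.integrable_sq
  refine (memLp_two_iff_integrable_sq hmeas).2 (hsq.integral_prod_left.mono' (hmeas.pow 2) ?_)
  filter_upwards [hsq.prod_right_ae, hh.1.prodMk_left] with x hx hxm
  have hx2 : MemLp (h x) 2 P := (memLp_two_iff_integrable_sq hxm).2 hx
  have hvar := variance_nonneg (h x) P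
  rw [variance_eq_sub hx2] at hvar
  rw [Real.norm_of_nonneg (sq_nonneg _)]
  exact sub_nonneg.1 hvar

lemma integral_hajekProj {h : S → S → ℝ}
    (hh : MemLp (fun p : S × S => h p.1 p.2) 2 (P.prod P)) :
    ∫ x, hajekProj P h x ∂P = ∫ p, h p.1 p.2 ∂(P.prod P) :=
  (integral_prod _ (hh.integrable one_le_two)).symm

lemma memLp_degeneratePart {h : S → S → ℝ}
    (hh : MemLp (fun p : S × S => h p.1 p.2) 2 (P.prod P)) :
    MemLp (fun p : S × S => degeneratePart P h p.1 p.2) 2 (P.prod P) := by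
  have hg := memLp_hajekProj hh
  exact ((hh.sub (hg.comp_measurePreserving measurePreserving_fst)).sub
    (hg.comp_measurePreserving measurePreserving_snd)).add (memLp_const _)

lemma integral_degeneratePart_left {h : S → S → ℝ} (hsymm : ∀ x y, h x y = h y x)
    (hh : MemLp (fun p : S × S => h p.1 p.2) 2 (P.prod P)) :
    ∀ᵐ y ∂P, ∫ x, degeneratePart P h x y ∂P = 0 := by
  have hg : Integrable (hajekProj P h) P := (memLp_hajekProj hh).integrable one_le_two
  filter_upwards [(hh.integrable one_le_two).prod_right_ae] with y hy
  simp only [degeneratePart, fun x => hsymm x y]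
  have hyg : Integrable (fun x => h y x - hajekProj P h x) P := hy.sub hg
  have hygc : Integrable (fun x => h y x - hajekProj P h x - hajekProj P h y) P :=
    hyg.sub (integrable_const _)
  rw [integral_add hygc (integrable_const _), integral_sub hyg (integrable_const _),
    integral_sub hy hg, integral_hajekProj hh]
  simp [hajekProj]

/-! ### Orthogonality and second moments of degenerate sums -/

/-- If `r` has vanishing first marginal integrals and `Y` is independent of `Z`, then
`r (Y, f Z)` is orthogonal to every square-integrable function of `Z`. -/
lemma integral_degenerate_mul_eq_zero {T : Type*} [MeasurableSpace T] {r : S → S → ℝ}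
    (hr : MemLp (fun p : S × S => r p.1 p.2) 2 (P.prod P))
    (hdeg : ∀ᵐ y ∂P, ∫ x, r x y ∂P = 0) {Q : Measure T} [IsProbabilityMeasure Q]
    {Y : Ω → S} {Z : Ω → T} (hYZ : HasLaw (fun ω => (Y ω, Z ω)) (P.prod Q) ν)
    {f : T → S} (hf : MeasurePreserving f Q P) {s : T → ℝ} (hs : MemLp s 2 Q) :
    ∫ ω, r (Y ω) (f (Z ω)) * s (Z ω) ∂ν = 0 := by
  have hr' : MemLp (fun p : S × T => r p.1 (f p.2)) 2 (P.prod Q) :=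
    hr.comp_measurePreserving ((MeasurePreserving.id P).prod hf)
  have hs' : MemLp (fun p : S × T => s p.2) 2 (P.prod Q) :=
    hs.comp_measurePreserving measurePreserving_snd
  have hint : Integrable (fun p : S × T => r p.1 (f p.2) * s p.2) (P.prod Q) :=
    hr'.integrable_mul hs'
  have hcomp := hYZ.integral_comp hint.1
  simp only [Function.comp_def] at hcomp
  -- Integrating over `Y` first leaves `s z` as a constant factor, so degeneracy applies fibrewise.
  rw [hcomp, integral_prod_symm _ hint]
  refine integral_eq_zero_of_ae ?_
  filter_upwards [hf.quasiMeasurePreserving.ae hdeg] with z hz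
  simp [integral_mul_const, hz]

variable [IsProbabilityMeasure ν]

lemma integral_mul_eq_zero_of_notMem (hX : ∀ i, HasLaw (X i) P ν) (hind : iIndepFun X ν)
    {r : S → S → ℝ} (hr : MemLp (fun p : S × S => r p.1 p.2) 2 (P.prod P))
    (hdeg : ∀ᵐ y ∂P, ∫ x, r x y ∂P = 0) {i j k l : ℕ} (hij : i ≠ j) (hik : i ≠ k) (hil : i ≠ l)
    (hkl : k ≠ l) :
    ∫ ω, r (X i ω) (X j ω) * r (X k ω) (X l ω) ∂ν = 0 := by
  -- `j` may coincide with `k` or `l`; a finset of indices absorbs the repetition, and `X i` is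
  -- independent of the whole block.
  let T : Finset ℕ := {j, k, l}
  have hjT : j ∈ T := by simp [T]
  have hkT : k ∈ T := by simp [T]
  have hlT : l ∈ T := by simp [T]
  let Z : Ω → (T → S) := fun ω t => X t ω
  have hZ : AEMeasurable Z ν := aemeasurable_pi_lambda _ fun t => (hX t).aemeasurable
  have hprob : IsProbabilityMeasure (ν.map Z) := Measure.isProbabilityMeasure_map hZ
  have hiZ : IndepFun (X i) Z ν := by
    have := hind.indepFun_finset₀ {i} T (by simp [T, hij, hik, hil]) fun t => (hX t).aemeasurable
    exact this.comp (φ := fun u : (({i} : Finset ℕ) → S) => u ⟨i, by simp⟩) (ψ := id)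
      (measurable_pi_apply _) measurable_id
  have hlaw : HasLaw (fun ω => (X i ω, Z ω)) (P.prod (ν.map Z)) ν :=
    ⟨(hX i).aemeasurable.prodMk hZ, by
      rw [hiZ.map_prod_eq_prod_map_map (hX i).aemeasurable hZ, (hX i).map_eq]⟩
  have hf : MeasurePreserving (fun z : T → S => z ⟨j, hjT⟩) (ν.map Z) P :=
    ⟨measurable_pi_apply _, by
      rw [AEMeasurable.map_map_of_aemeasurable (measurable_pi_apply _).aemeasurable hZ]
      exact (hX j).map_eq⟩
  have hs : MeasurePreserving (fun z : T → S => (z ⟨k, hkT⟩, z ⟨l, hlT⟩)) (ν.map Z)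
      (P.prod P) :=
    ⟨(measurable_pi_apply _).prodMk (measurable_pi_apply _), by
      rw [AEMeasurable.map_map_of_aemeasurable
        ((measurable_pi_apply _).prodMk (measurable_pi_apply _)).aemeasurable hZ]
      exact (hasLaw_pair hX hind hkl).map_eq⟩
  exact integral_degenerate_mul_eq_zero hr hdeg hlaw hf (hr.comp_measurePreserving hs)

lemma integral_mul_eq_zero_of_ne (hX : ∀ i, HasLaw (X i) P ν) (hind : iIndepFun X ν)
    {r : S → S → ℝ} (hr : MemLp (fun p : S × S => r p.1 p.2) 2 (P.prod P))
    (hsymm : ∀ x y, r x y = r y x) (hdeg : ∀ᵐ y ∂P, ∫ x, r x y ∂P = 0) {p q : ℕ × ℕ}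
    (hp : p.1 ≠ p.2) (hq : q.1 ≠ q.2) (hqp : q ≠ p) (hqp' : q ≠ p.swap) :
    ∫ ω, r (X p.1 ω) (X p.2 ω) * r (X q.1 ω) (X q.2 ω) ∂ν = 0 := by
  obtain ⟨i, j⟩ := p
  obtain ⟨k, l⟩ := q
  simp only [ne_eq, Prod.mk.injEq, Prod.swap_prod_mk] at *
  by_cases hi : i ≠ k ∧ i ≠ l
  · exact integral_mul_eq_zero_of_notMem hX hind hr hdeg hp hi.1 hi.2 hq
  -- If `i` and `j` both occurred in `q`, then `q` would be `p` or its swap.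
  · have hj : j ≠ k ∧ j ≠ l := by omega
    simp_rw [fun ω => hsymm (X i ω) (X j ω)]
    exact integral_mul_eq_zero_of_notMem hX hind hr hdeg (Ne.symm hp) hj.1 hj.2 hq

/-- On expanding the square, an ordered pair interacts only with itself and its swap, whence the
factor 2. -/
lemma integral_sq_sum_offDiag_le (hX : ∀ i, HasLaw (X i) P ν) (hind : iIndepFun X ν)
    {r : S → S → ℝ} (hr : MemLp (fun p : S × S => r p.1 p.2) 2 (P.prod P))
    (hsymm : ∀ x y, r x y = r y x) (hdeg : ∀ᵐ y ∂P, ∫ x, r x y ∂P = 0) (n : ℕ) :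
    ∫ ω, (∑ p ∈ (Finset.range n).offDiag, r (X p.1 ω) (X p.2 ω)) ^ 2 ∂ν ≤
      (n * (n - 1)) * (2 * ∫ p, r p.1 p.2 ^ 2 ∂(P.prod P)) := by
  set D := (Finset.range n).offDiag
  set M := ∫ p, r p.1 p.2 ^ 2 ∂(P.prod P)
  have hne : ∀ p ∈ D, p.1 ≠ p.2 := fun p hp => (Finset.mem_offDiag.1 hp).2.2
  have hL : ∀ p ∈ D, MemLp (fun ω => r (X p.1 ω) (X p.2 ω)) 2 ν := fun p hp =>
    memLp_comp_pair hX hind (hne p hp) hr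
  have hint : ∀ p ∈ D, ∀ q ∈ D,
      Integrable (fun ω => r (X p.1 ω) (X p.2 ω) * r (X q.1 ω) (X q.2 ω)) ν := fun p hp q hq =>
    (hL p hp).integrable_mul (hL q hq)
  have hM : 0 ≤ M := integral_nonneg fun _ => sq_nonneg _
  have hdiag : ∀ p ∈ D, ∫ ω, r (X p.1 ω) (X p.2 ω) * r (X p.1 ω) (X p.2 ω) ∂ν = M := by
    intro p hp
    have := (hasLaw_pair hX hind (hne p hp)).integral_comp hr.integrable_sq.1
    simp only [Function.comp_def] at this
    simp_rw [← pow_two]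
    exact this
  have hrow : ∀ p ∈ D,
      ∑ q ∈ D, ∫ ω, r (X p.1 ω) (X p.2 ω) * r (X q.1 ω) (X q.2 ω) ∂ν ≤ 2 * M := by
    intro p hp
    calc ∑ q ∈ D, ∫ ω, r (X p.1 ω) (X p.2 ω) * r (X q.1 ω) (X q.2 ω) ∂ν
        ≤ ∑ q ∈ D, ((if q = p then M else 0) + (if q = p.swap then M else 0)) := by
          refine Finset.sum_le_sum fun q hq => ?_
          by_cases h1 : q = p
          · subst h1
            rw [hdiag q hq, if_pos rfl]
            split_ifs <;> linarith
          · by_cases h2 : q = p.swap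
            · subst h2
              simp only [Prod.fst_swap, Prod.snd_swap, fun ω => hsymm (X p.2 ω) (X p.1 ω)]
              rw [hdiag p hp, if_neg h1, if_pos trivial, zero_add]
            · rw [integral_mul_eq_zero_of_ne hX hind hr hsymm hdeg (hne p hp) (hne q hq) h1 h2]
              simp [h1, h2]
      _ ≤ 2 * M := by
          rw [Finset.sum_add_distrib, Finset.sum_ite_eq', Finset.sum_ite_eq', two_mul]
          gcongr <;> split_ifs <;> linarith
  have hcard : (D.card : ℝ) = n * (n - 1) := by
    rw [Finset.offDiag_card, Finset.card_range, Nat.cast_sub (Nat.le_mul_self n)]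
    push_cast
    ring
  calc ∫ ω, (∑ p ∈ D, r (X p.1 ω) (X p.2 ω)) ^ 2 ∂ν
      = ∑ p ∈ D, ∑ q ∈ D, ∫ ω, r (X p.1 ω) (X p.2 ω) * r (X q.1 ω) (X q.2 ω) ∂ν := by
        simp_rw [pow_two, Finset.sum_mul_sum]
        rw [integral_finsetSum _ fun p hp => integrable_finsetSum _ (hint p hp)]
        exact Finset.sum_congr rfl fun p hp => integral_finsetSum _ (hint p hp)
    _ ≤ ∑ p ∈ D, 2 * M := Finset.sum_le_sum hrow
    _ = (n * (n - 1)) * (2 * M) := by rw [Finset.sum_const, nsmul_eq_mul, hcard]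

/-! ### Hoeffding decomposition and limit theorem -/

lemma sum_offDiag_fst_add_snd (a : ℕ → ℝ) (n : ℕ) :
    ∑ p ∈ (Finset.range n).offDiag, (a p.1 + a p.2) =
      2 * ((n : ℝ) - 1) * ∑ i ∈ Finset.range n, a i := by
  have h := Finset.sum_product (Finset.range n) (Finset.range n)
    (fun p : ℕ × ℕ => a p.1 + a p.2)
  rw [← Finset.diag_union_offDiag, Finset.sum_union (Finset.disjoint_diag_offDiag _),
    Finset.sum_diag] at h
  simp only [Finset.sum_add_distrib, Finset.sum_const, Finset.card_range, nsmul_eq_mul,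
    ← Finset.mul_sum] at h
  rw [Finset.sum_add_distrib]
  linarith

/-- The Hoeffding decomposition of a U-statistic of order two. -/
lemma uStat_sub_eq (P : Measure S) (h : S → S → ℝ) (x : ℕ → S) {n : ℕ} (hn : 2 ≤ n) :
    √(n : ℝ) * (((n : ℝ) * ((n : ℝ) - 1))⁻¹ *
        ∑ p ∈ (Finset.range n).offDiag, h (x p.1) (x p.2) - ∫ p, h p.1 p.2 ∂(P.prod P)) -
      (√(n : ℝ))⁻¹ * (∑ i ∈ Finset.range n, 2 * hajekProj P h (x i) -
        n * (2 * ∫ p, h p.1 p.2 ∂(P.prod P))) =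
    √(n : ℝ) * ((n : ℝ) * ((n : ℝ) - 1))⁻¹ *
      ∑ p ∈ (Finset.range n).offDiag, degeneratePart P h (x p.1) (x p.2) := by
  set θ := ∫ p, h p.1 p.2 ∂(P.prod P) with hθ
  have hn' : (2 : ℝ) ≤ n := by exact_mod_cast hn
  have hn0 : (n : ℝ) ≠ 0 := by positivity
  have hn1 : (n : ℝ) - 1 ≠ 0 := by linarith
  have hcard : (((Finset.range n).offDiag).card : ℝ) = n * (n - 1) := by
    rw [Finset.offDiag_card, Finset.card_range, Nat.cast_sub (Nat.le_mul_self n)]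
    push_cast
    ring
  have hr : ∑ p ∈ (Finset.range n).offDiag, degeneratePart P h (x p.1) (x p.2) =
      ∑ p ∈ (Finset.range n).offDiag, h (x p.1) (x p.2) -
        2 * ((n : ℝ) - 1) * ∑ i ∈ Finset.range n, hajekProj P h (x i) + n * (n - 1) * θ := by
    rw [← sum_offDiag_fst_add_snd, ← hcard, ← nsmul_eq_mul, ← Finset.sum_const,
      ← Finset.sum_sub_distrib, ← Finset.sum_add_distrib]
    refine Finset.sum_congr rfl fun p _ => ?_
    simp only [degeneratePart, ← hθ]
    ring
  have hs : (√(n : ℝ))⁻¹ = √(n : ℝ) * (n : ℝ)⁻¹ := by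
    have h0 : √(n : ℝ) ≠ 0 := by positivity
    have h2 : √(n : ℝ) * √(n : ℝ) = n := Real.mul_self_sqrt (Nat.cast_nonneg n)
    field_simp
    rw [pow_two, h2]
  rw [hr, hs, ← Finset.mul_sum]
  field_simp
  ring

/-- The degenerate part of a U-statistic is negligible at the scale `√n`. -/
lemma tendstoInMeasure_degenerate (hX : ∀ i, HasLaw (X i) P ν) (hind : iIndepFun X ν)
    {r : S → S → ℝ} (hr : MemLp (fun p : S × S => r p.1 p.2) 2 (P.prod P))
    (hsymm : ∀ x y, r x y = r y x) (hdeg : ∀ᵐ y ∂P, ∫ x, r x y ∂P = 0) :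
    TendstoInMeasure ν (fun (n : ℕ) ω => √(n : ℝ) * ((n : ℝ) * ((n : ℝ) - 1))⁻¹ *
      ∑ p ∈ (Finset.range n).offDiag, r (X p.1 ω) (X p.2 ω)) atTop 0 := by
  set M := ∫ p, r p.1 p.2 ^ 2 ∂(P.prod P)
  have hM : 0 ≤ M := integral_nonneg fun _ => sq_nonneg _
  have hL (n : ℕ) : MemLp (fun ω => √(n : ℝ) * ((n : ℝ) * ((n : ℝ) - 1))⁻¹ *
      ∑ p ∈ (Finset.range n).offDiag, r (X p.1 ω) (X p.2 ω)) 2 ν :=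
    (memLp_finsetSum _ fun p hp =>
      memLp_comp_pair hX hind (Finset.mem_offDiag.1 hp).2.2 hr).const_mul _
  refine tendstoInMeasure_of_tendsto_eLpNorm two_ne_zero (fun n => (hL n).1)
    aestronglyMeasurable_const ?_
  have hbound : ∀ᶠ n : ℕ in atTop, eLpNorm ((fun ω => √(n : ℝ) * ((n : ℝ) * ((n : ℝ) - 1))⁻¹ *
      ∑ p ∈ (Finset.range n).offDiag, r (X p.1 ω) (X p.2 ω)) - 0) 2 ν ≤
      ENNReal.ofReal (√(2 * M * ((n : ℝ) - 1)⁻¹)) := by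
    filter_upwards [eventually_ge_atTop 2] with n hn
    have hn' : (2 : ℝ) ≤ n := by exact_mod_cast hn
    have hn0 : (n : ℝ) ≠ 0 := by positivity
    have hn1 : (0 : ℝ) < (n : ℝ) - 1 := by linarith
    rw [sub_zero, (hL n).eLpNorm_eq_integral_rpow_norm two_ne_zero ENNReal.ofNat_ne_top]
    refine ENNReal.ofReal_le_ofReal ?_
    simp only [ENNReal.toReal_ofNat, Real.rpow_ofNat, Real.norm_eq_abs, sq_abs]
    rw [← one_div (2 : ℝ), ← Real.sqrt_eq_rpow]
    refine Real.sqrt_le_sqrt ?_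
    simp_rw [mul_pow]
    rw [integral_const_mul, Real.sq_sqrt (Nat.cast_nonneg n)]
    -- The bound is `n · (n(n-1))⁻² · n(n-1) · 2M = 2M/(n-1)`.
    refine (mul_le_mul_of_nonneg_left
      (integral_sq_sum_offDiag_le hX hind hr hsymm hdeg n) (by positivity)).trans_eq ?_
    have := hn1.ne'
    field_simp
    rfl
  refine tendsto_of_tendsto_of_tendsto_of_le_of_le' tendsto_const_nhds ?_
    (Eventually.of_forall fun _ => zero_le) hbound
  have h0 : Tendsto (fun n : ℕ => ((n : ℝ) - 1)⁻¹) atTop (nhds 0) :=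
    tendsto_inv_atTop_zero.comp
      (tendsto_atTop_add_const_right _ (-1) tendsto_natCast_atTop_atTop)
  have h1 := ENNReal.tendsto_ofReal ((h0.const_mul (2 * M)).sqrt)
  simpa using h1

/-- **Central limit theorem for U-statistics** of order two with a symmetric, square-integrable
kernel. -/
theorem tendstoInDistribution_uStat {h : S → S → ℝ} (hsymm : ∀ x y, h x y = h y x)
    (hh : MemLp (fun p : S × S => h p.1 p.2) 2 (P.prod P))
    (hX : ∀ i, HasLaw (X i) P ν) (hind : iIndepFun X ν) :
    TendstoInDistribution
      (fun (n : ℕ) ω => √(n : ℝ) * (((n : ℝ) * ((n : ℝ) - 1))⁻¹ *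
        ∑ p ∈ (Finset.range n).offDiag, h (X p.1 ω) (X p.2 ω) - ∫ p, h p.1 p.2 ∂(P.prod P)))
      atTop (id : ℝ → ℝ) (fun _ => ν)
      (gaussianReal 0 Var[fun x => 2 * hajekProj P h x; P].toNNReal) := by
  let g : S → ℝ := fun x => 2 * hajekProj P h x
  have hg : MemLp g 2 P := (memLp_hajekProj hh).const_mul 2
  have hgmap (i : ℕ) : AEMeasurable g (ν.map (X i)) := by
    rw [(hX i).map_eq]
    exact hg.1.aemeasurable
  have hmean : ∫ ω, g (X 0 ω) ∂ν = 2 * ∫ p, h p.1 p.2 ∂(P.prod P) := by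
    have := (hX 0).integral_comp hg.1
    simp only [Function.comp_def] at this
    rw [this, integral_const_mul, integral_hajekProj hh]
  have hident (i : ℕ) : IdentDistrib (fun ω => g (X i ω)) (fun ω => g (X 0 ω)) ν ν :=
    IdentDistrib.comp_of_aemeasurable (f := X i) (g := X 0) (u := g)
      ⟨(hX i).aemeasurable, (hX 0).aemeasurable, by rw [(hX i).map_eq, (hX 0).map_eq]⟩ (hgmap i)
  have hvar : Var[fun ω => g (X 0 ω); ν] = Var[g; P] := by
    rw [← (hX 0).map_eq, variance_map (hgmap 0) (hX 0).aemeasurable]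
    rfl
  have hmem : MemLp (fun ω => g (X 0 ω)) 2 ν := by
    have hg' := hg
    rw [← (hX 0).map_eq] at hg'
    exact (memLp_map_measure_iff hg'.1 (hX 0).aemeasurable).1 hg'
  have hclt := tendstoInDistribution_inv_sqrt_mul_sum_sub (X := fun i ω => g (X i ω))
    (P := ν) (P' := gaussianReal 0 Var[g; P].toNNReal) (Y := id)
    (by rw [hvar]; exact HasLaw.id) hmem
    (hind.comp₀ (fun _ => g) (fun i => (hX i).aemeasurable) hgmap) hident
  rw [hmean] at hclt
  -- Slutsky: the difference from the i.i.d. sum is the degenerate term once `n ≥ 2`, where `n(n-1)`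
  -- is invertible.
  refine tendstoInDistribution_of_tendstoInMeasure_sub _ _ hclt ?_ fun n => ?_
  · refine (tendstoInMeasure_degenerate hX hind (memLp_degeneratePart hh)
      (degeneratePart_comm hsymm) (integral_degeneratePart_left hsymm hh)).congr' ?_ .rfl
    filter_upwards [eventually_ge_atTop 2] with n hn
    exact .of_forall fun ω => (uStat_sub_eq P h (fun i => X i ω) hn).symm
  · refine AEMeasurable.const_mul (AEMeasurable.sub_const (AEMeasurable.const_mul
      (Finset.aemeasurable_fun_sum _ fun p hp => ?_) _) _) _
    exact (memLp_comp_pair hX hind (Finset.mem_offDiag.1 hp).2.2 hh).1.aemeasurable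

end UStatistic

lemma hHat_comm {𝒜 ℬ 𝒞 HA HB : Type*} (HC : Type*)
    [NormedAddCommGroup HA] [InnerProductSpace ℝ HA] [CompleteSpace HA] [RKHS ℝ HA 𝒜 ℝ]
    [NormedAddCommGroup HB] [InnerProductSpace ℝ HB] [CompleteSpace HB] [RKHS ℝ HB ℬ ℝ]
    [NormedAddCommGroup HC] [InnerProductSpace ℝ HC] [CompleteSpace HC] [RKHS ℝ HC 𝒞 ℝ]
    (μA : 𝒞 → HA) (μB : 𝒞 → HB) (x x' : 𝒜 × ℬ × 𝒞) :
    hHat HC μA μB x x' = hHat HC μA μB x' x := by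
  simp only [hHat, kernelFn]
  rw [real_inner_comm, real_inner_comm (featureMap HA x'.1 - _),
    real_inner_comm (featureMap HB x'.2.1 - _)]

end KCI

theorem mainTheorem7 {𝒜 ℬ 𝒞 HA HB HC : Type*}
    [MeasurableSpace 𝒜] [MeasurableSpace ℬ] [MeasurableSpace 𝒞]
    [NormedAddCommGroup HA] [InnerProductSpace ℝ HA] [CompleteSpace HA]
    [TopologicalSpace.SeparableSpace HA] [RKHS ℝ HA 𝒜 ℝ]
    [NormedAddCommGroup HB] [InnerProductSpace ℝ HB] [CompleteSpace HB]
    [TopologicalSpace.SeparableSpace HB] [RKHS ℝ HB ℬ ℝ]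
    [NormedAddCommGroup HC] [InnerProductSpace ℝ HC] [CompleteSpace HC]
    [TopologicalSpace.SeparableSpace HC] [RKHS ℝ HC 𝒞 ℝ]
    (hkA : Measurable fun p : 𝒜 × 𝒜 => kernelFn HA p.1 p.2)
    (hkB : Measurable fun p : ℬ × ℬ => kernelFn HB p.1 p.2)
    (hkC : Measurable fun p : 𝒞 × 𝒞 => kernelFn HC p.1 p.2)
    (μA : 𝒞 → HA) (hμA : StronglyMeasurable μA)
    (μB : 𝒞 → HB) (hμB : StronglyMeasurable μB)
    (P : Measure (𝒜 × ℬ × 𝒞)) [IsProbabilityMeasure P]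
    (hmom : MemLp (fun p : (𝒜 × ℬ × 𝒞) × (𝒜 × ℬ × 𝒞) => hHat HC μA μB p.1 p.2) 2 (P.prod P))
    (halt : ¬ CondIndepGiven (fun x : 𝒜 × ℬ × 𝒞 => x.1) (fun x => x.2.1) (fun x => x.2.2) P) :
    ∃ σsq : NNReal, ∀ (Ω : Type*) [MeasurableSpace Ω] (ν : Measure Ω) [IsProbabilityMeasure ν]
      (X : ℕ → Ω → 𝒜 × ℬ × 𝒞), (∀ i, HasLaw (X i) P ν) → iIndepFun X ν →
      TendstoInDistribution
        (fun (n : ℕ) ω => √(n : ℝ) *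
          (kciHatStat HC μA μB n (fun i => X i ω) - kciHat HC μA μB P))
        atTop (id : ℝ → ℝ) (fun _ => ν) (gaussianReal 0 σsq) := by
  -- Unification takes for the witness the variance under `P` of twice the projection of `ĥ`, chosen
  -- before the sample; it may be zero.
  exact ⟨_, fun Ω _ ν _ X hX hind => tendstoInDistribution_uStat (hHat_comm HC μA μB) hmom hX hind⟩
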